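/- Let $\mathbb{D}$ be the open unit disc and let $H^2$ be the Hardy space of holomorphic functions $f$ on $\mathbb{D}$ with $\sup_{0\le r<1}\frac1{2\pi}\int_0^{2\pi}|f(re^{it})|^2\,dt<\infty$. An inner function is a holomorphic function $\theta$ on $\mathbb{D}$ with $|\theta|\le 1$ on $\mathbb{D}$ whose radial limits have modulus one almost everywhere on $\partial\mathbb{D}$. Let $\varphi:\mathbb{D}\to\mathbb{D}$ be holomorphic and not an automorphism of $\mathbb{D}$, and suppose that $\varphi(w)=w$ for some $w\in\mathbb{D}$. Write $C_\varphi f=f\circ\varphi$, and say that $\theta H^2=\{\theta f: f\in H^2\}$ is invariant under $C_\varphi$ if $C_\varphi(\theta H^2)\subseteq\theta H^2$. If $\theta$ is an inner function with $\theta(w)\neq 0$, then $\theta H^2$ is invariant under $C_\varphi$ if and only if $\theta$ is a unimodular constant. In particular, if $\theta$ is a nonconstant singular inner function, that is, an inner function of the form $$\theta(z)=c\exp\Big(-\int_0^{2\pi}\frac{e^{it}+z}{e^{it}-z}\,d\mu(t)\Big)\qquad(z\in\mathbb{D})$$ with $|c|=1$ and $\mu\neq 0$ a finite positive Borel measure on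 $[0,2\pi]$ that is singular with respect to Lebesgue measure, then $\theta H^2$ is not invariant under $C_\varphi$. -/

import Mathlib

open Set Filter Topology MeasureTheory Metric

noncomputable section

/- Functions on the open unit disc are represented by functions `ℂ → ℂ`; all notions below only
see their values on `ball 0 1`. -/

/-- `φ` is a holomorphic self map of the open unit disc. -/
def IsDiscSelfMap (φ : ℂ → ℂ) : Prop :=
  DifferentiableOn ℂ φ (ball 0 1) ∧ MapsTo φ (ball 0 1) (ball 0 1)

/-- `φ` is a (holomorphic) automorphism of the open unit disc: a holomorphic self map with a
two-sided inverse that is a holomorphic self map. -/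
def IsDiscAutomorphism (φ : ℂ → ℂ) : Prop :=
  IsDiscSelfMap φ ∧ ∃ ψ : ℂ → ℂ, IsDiscSelfMap ψ ∧
    (∀ z ∈ ball (0 : ℂ) 1, ψ (φ z) = z) ∧ (∀ z ∈ ball (0 : ℂ) 1, φ (ψ z) = z)

/-- The integral mean `((1/2π) ∫₀^{2π} |f(r e^{it})|² dt)^{1/2}`. -/
def hardyMean (f : ℂ → ℂ) (r : ℝ) : ℝ :=
  Real.sqrt (Real.circleAverage (fun z => ‖f z‖ ^ 2) 0 r)

/-- The Hardy space `H²` of the disc: the functions holomorphic on the disc with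
`sup_{0 ≤ r < 1} hardyMean f r < ∞`. -/
def HardySpace : Set (ℂ → ℂ) :=
  {f | DifferentiableOn ℂ f (ball 0 1) ∧ BddAbove (hardyMean f '' Ico 0 1)}

/-- `θ` is an inner function: holomorphic on the disc, bounded by one in modulus there, with radial
limits of modulus one at almost every point of the unit circle. -/
def IsInner (θ : ℂ → ℂ) : Prop :=
  DifferentiableOn ℂ θ (ball 0 1) ∧ (∀ z ∈ ball (0 : ℂ) 1, ‖θ z‖ ≤ 1) ∧
    ∀ᵐ t : ℝ ∂(volume.restrict (Icc 0 (2 * Real.pi))),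
      ∃ ζ : ℂ, ‖ζ‖ = 1 ∧ Tendsto (fun r : ℝ => θ (circleMap 0 r t)) (𝓝[<] 1) (𝓝 ζ)

/-- `θ` is a (nontrivial) singular inner function: an inner function given on the disc by
`θ(z) = c exp (-∫ (e^{it} + z) / (e^{it} - z) dμ(t))` with `|c| = 1` and `μ` a nonzero finite
positive measure on `[0, 2π]` that is singular with respect to Lebesgue measure. -/
def IsSingularInner (θ : ℂ → ℂ) : Prop :=
  IsInner θ ∧ ∃ (c : ℂ) (μ : Measure ℝ), ‖c‖ = 1 ∧ IsFiniteMeasure μ ∧ μ ≠ 0 ∧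
    μ (Icc 0 (2 * Real.pi))ᶜ = 0 ∧ μ ⟂ₘ volume ∧
    ∀ z ∈ ball (0 : ℂ) 1,
      θ z = c * Complex.exp (-∫ t, (circleMap 0 1 t + z) / (circleMap 0 1 t - z) ∂μ)

/-- The Beurling type space `θ H²` (as functions on the disc). -/
def beurlingSpace (θ : ℂ → ℂ) : Set (ℂ → ℂ) :=
  {h | ∃ f ∈ HardySpace, EqOn h (fun z => θ z * f z) (ball 0 1)}

/-- The composition operator `C_φ f = f ∘ φ`. -/
def compositionOp (φ f : ℂ → ℂ) : ℂ → ℂ := fun z => f (φ z)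

/-- `θ H²` is invariant under `C_φ`, that is, `C_φ (θ H²) ⊆ θ H²`. -/
def BeurlingInvariant (φ θ : ℂ → ℂ) : Prop :=
  compositionOp φ '' beurlingSpace θ ⊆ beurlingSpace θ

end

/-- The disc involution exchanging `0` and `w`. -/
noncomputable def discInvolution (w z : ℂ) : ℂ := (w - z) / (1 - starRingEnd ℂ w * z)

lemma discInvolution_self (w : ℂ) : discInvolution w w = 0 := by simp [discInvolution]

lemma discInvolution_zero (w : ℂ) : discInvolution w 0 = w := by simp [discInvolution]

lemma one_sub_conj_mul_ne_zero {w z : ℂ} (hw : w ∈ ball (0 : ℂ) 1) (hz : z ∈ ball (0 : ℂ) 1) :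
    1 - starRingEnd ℂ w * z ≠ 0 := by
  rw [mem_ball_zero_iff] at hw hz
  intro h
  have h1 : ‖starRingEnd ℂ w * z‖ = 1 := by rw [← sub_eq_zero.1 h, norm_one]
  rw [norm_mul, Complex.norm_conj] at h1
  nlinarith [norm_nonneg w, norm_nonneg z]

lemma isDiscSelfMap_discInvolution {w : ℂ} (hw : w ∈ ball (0 : ℂ) 1) :
    IsDiscSelfMap (discInvolution w) := by
  refine ⟨?_, fun z hz => ?_⟩
  · refine DifferentiableOn.div (by fun_prop) (by fun_prop) fun z hz => ?_
    exact one_sub_conj_mul_ne_zero hw hz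
  · have hne := one_sub_conj_mul_ne_zero hw hz
    rw [mem_ball_zero_iff] at hw hz ⊢
    rw [discInvolution, norm_div, div_lt_one (norm_pos_iff.2 hne)]
    refine lt_of_pow_lt_pow_left₀ 2 (norm_nonneg _) ?_
    have hw2 : ‖w‖ ^ 2 < 1 := by nlinarith [norm_nonneg w]
    have hz2 : ‖z‖ ^ 2 < 1 := by nlinarith [norm_nonneg z]
    rw [← Complex.normSq_eq_norm_sq] at hw2 hz2 ⊢
    rw [← Complex.normSq_eq_norm_sq]
    simp only [Complex.normSq_apply, Complex.sub_re, Complex.sub_im, Complex.mul_re,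
      Complex.mul_im, Complex.conj_re, Complex.conj_im, Complex.one_re, Complex.one_im]
      at hw2 hz2 ⊢
    nlinarith [mul_pos (sub_pos.2 hw2) (sub_pos.2 hz2)]

lemma discInvolution_discInvolution {w z : ℂ} (hw : w ∈ ball (0 : ℂ) 1)
    (hz : z ∈ ball (0 : ℂ) 1) : discInvolution w (discInvolution w z) = z := by
  have h1 := one_sub_conj_mul_ne_zero hw hz
  have h2 := one_sub_conj_mul_ne_zero hw hw
  have h3 := one_sub_conj_mul_ne_zero hw ((isDiscSelfMap_discInvolution hw).2 hz)
  have h4 : w - discInvolution w z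
      = z * (1 - starRingEnd ℂ w * w) / (1 - starRingEnd ℂ w * z) := by
    rw [discInvolution, eq_div_iff h1, sub_mul, div_mul_cancel₀ _ h1]; ring
  have h5 : 1 - starRingEnd ℂ w * discInvolution w z
      = (1 - starRingEnd ℂ w * w) / (1 - starRingEnd ℂ w * z) := by
    rw [discInvolution, eq_div_iff h1, sub_mul, mul_assoc, div_mul_cancel₀ _ h1]; ring
  rw [discInvolution, h4, h5, div_div_div_cancel_right₀ h1, mul_div_cancel_right₀ _ h2]

lemma IsDiscSelfMap.comp {f g : ℂ → ℂ} (hf : IsDiscSelfMap f) (hg : IsDiscSelfMap g) :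
    IsDiscSelfMap (f ∘ g) := ⟨hf.1.comp hg.1 hg.2, hf.2.comp hg.2⟩

lemma isDiscSelfMap_const_mul {c : ℂ} (hc : ‖c‖ = 1) : IsDiscSelfMap (fun z => c * z) :=
  ⟨by fun_prop, fun z hz => by simpa [hc] using hz⟩

/-- Equality in the Schwarz lemma away from the origin forces a rotation. -/
lemma exists_rotation_of_norm_eq {ψ : ℂ → ℂ} (hψ : IsDiscSelfMap ψ) (h0 : ψ 0 = 0) {z₀ : ℂ}
    (hz₀ : z₀ ∈ ball (0 : ℂ) 1) (hne : z₀ ≠ 0) (heq : ‖ψ z₀‖ = ‖z₀‖) :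
    ∃ c : ℂ, ‖c‖ = 1 ∧ ∀ z ∈ ball (0 : ℂ) 1, ψ z = c * z := by
  have hd : ‖dslope ψ 0 z₀‖ = 1 := by
    rw [dslope_of_ne _ hne, slope_def_field, h0, sub_zero, sub_zero, norm_div, heq,
      div_self (norm_ne_zero_iff.2 hne)]
  refine ⟨dslope ψ 0 z₀, hd, fun z hz => ?_⟩
  have := Complex.affine_of_mapsTo_ball_of_norm_dslope_eq_div (R₂ := 1) hψ.1
    (by rw [h0]; exact hψ.2.mono_right ball_subset_closedBall) hz₀ (by simpa using hd) hz
  simpa [h0, mul_comm] using this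

/-- The Schwarz lemma at an interior fixed point, for a self map that is not an automorphism. -/
lemma norm_conj_lt_of_not_automorphism {φ : ℂ → ℂ} (hφ : IsDiscSelfMap φ)
    (hna : ¬ IsDiscAutomorphism φ) {w : ℂ} (hw : w ∈ ball (0 : ℂ) 1) (hfix : φ w = w) {z : ℂ}
    (hz : z ∈ ball (0 : ℂ) 1) (hne : z ≠ 0) :
    ‖discInvolution w (φ (discInvolution w z))‖ < ‖z‖ := by
  have hb := isDiscSelfMap_discInvolution hw
  have hψ := hb.comp (hφ.comp hb)
  have h0 : (discInvolution w ∘ φ ∘ discInvolution w) 0 = 0 := by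
    simp [discInvolution_zero, hfix, discInvolution_self]
  have hle := Complex.norm_le_norm_of_mapsTo_ball hψ.1
    (hψ.2.mono_right ball_subset_closedBall) h0 (mem_ball_zero_iff.1 hz)
  refine lt_of_le_of_ne hle fun heq => hna ?_
  obtain ⟨c, hc, hrot⟩ := exists_rotation_of_norm_eq hψ h0 hz hne heq
  have hc0 : c ≠ 0 := by rintro rfl; simp at hc
  have hcm := isDiscSelfMap_const_mul hc
  have hcm' := isDiscSelfMap_const_mul (c := c⁻¹) (by simp [hc])
  have key : ∀ u ∈ ball (0 : ℂ) 1, φ u = discInvolution w (c * discInvolution w u) := by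
    intro u hu
    rw [← hrot _ (hb.2 hu)]
    simp only [Function.comp_apply]
    rw [discInvolution_discInvolution hw hu, discInvolution_discInvolution hw (hφ.2 hu)]
  have hinv := hb.comp (hcm'.comp hb)
  refine ⟨hφ, _, hinv, fun u hu => ?_, fun u hu => ?_⟩
  · simp only [Function.comp_apply]
    rw [key u hu, discInvolution_discInvolution hw (hcm.2 (hb.2 hu)), inv_mul_cancel_left₀ hc0,
      discInvolution_discInvolution hw hu]
  · rw [key _ (hinv.2 hu)]
    simp only [Function.comp_apply]
    rw [discInvolution_discInvolution hw (hcm'.2 (hb.2 hu)), mul_inv_cancel_left₀ hc0,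
      discInvolution_discInvolution hw hu]

lemma eq_zero_of_invariant_of_norm_lt {F ψ : ℂ → ℂ} (hF : DifferentiableOn ℂ F (ball 0 1))
    (hF0 : F 0 = 0) (hψ : ∀ z ∈ ball (0 : ℂ) 1, z ≠ 0 → ‖ψ z‖ < ‖z‖)
    (hinv : ∀ z ∈ ball (0 : ℂ) 1, F (ψ z) = F z) {z : ℂ} (hz : z ∈ ball (0 : ℂ) 1) : F z = 0 := by
  have hz' := mem_ball_zero_iff.1 hz
  have hsub : closedBall (0 : ℂ) ‖z‖ ⊆ ball 0 1 := closedBall_subset_ball hz'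
  obtain ⟨x, hx, hmax⟩ := (isCompact_closedBall (0 : ℂ) ‖z‖).exists_isMaxOn
    ⟨0, by simp⟩ (hF.continuousOn.mono hsub).norm
  rcases eq_or_ne x 0 with rfl | hx0
  · have : ‖F z‖ ≤ ‖F 0‖ := hmax (show z ∈ closedBall (0 : ℂ) ‖z‖ by simp)
    simpa [hF0] using this
  have hy : ‖ψ x‖ < ‖z‖ := (hψ x (hsub hx) hx0).trans_le (mem_closedBall_zero_iff.1 hx)
  have hmaxy : IsMaxOn (norm ∘ F) (ball 0 ‖z‖) (ψ x) := fun u hu => by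
    have : ‖F u‖ ≤ ‖F x‖ := hmax (ball_subset_closedBall hu)
    simpa [hinv x (hsub hx)] using this
  have hconst := Complex.norm_eqOn_closure_of_isPreconnected_of_isMaxOn
    (convex_ball 0 ‖z‖).isPreconnected isOpen_ball
    ((hF.mono hsub).diffContOnCl_ball Subset.rfl) (mem_ball_zero_iff.2 hy) hmaxy
  have hz0 : ‖z‖ ≠ 0 := ((norm_nonneg _).trans_lt hy).ne'
  rw [closure_ball _ hz0] at hconst
  have h1 := hconst (show z ∈ closedBall (0 : ℂ) ‖z‖ by simp)
  have h2 := hconst (show (0 : ℂ) ∈ closedBall (0 : ℂ) ‖z‖ by simp)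
  simp only [Function.comp_apply, Function.const_apply, hF0, norm_zero] at h1 h2
  rwa [← h2, norm_eq_zero] at h1

/-- A holomorphic function fixed by `C_φ` is constant if `φ` is not an automorphism and has an
interior fixed point. -/
lemma eq_const_of_comp_eq {φ θ : ℂ → ℂ} (hφ : IsDiscSelfMap φ)
    (hna : ¬ IsDiscAutomorphism φ) {w : ℂ} (hw : w ∈ ball (0 : ℂ) 1) (hfix : φ w = w)
    (hθ : DifferentiableOn ℂ θ (ball 0 1)) (hinv : ∀ z ∈ ball (0 : ℂ) 1, θ (φ z) = θ z) {z : ℂ}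
    (hz : z ∈ ball (0 : ℂ) 1) : θ z = θ w := by
  have hb := isDiscSelfMap_discInvolution hw
  have := eq_zero_of_invariant_of_norm_lt
    (F := fun z => θ (discInvolution w z) - θ w)
    (ψ := fun z => discInvolution w (φ (discInvolution w z)))
    ((hθ.comp hb.1 hb.2).sub_const _) (by simp [discInvolution_zero])
    (fun u hu hne => norm_conj_lt_of_not_automorphism hφ hna hw hfix hu hne)
    (fun u hu => by
      rw [discInvolution_discInvolution hw (hφ.2 (hb.2 hu)), hinv _ (hb.2 hu)])
    (hb.2 hz)
  simp only [discInvolution_discInvolution hw hz] at this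
  exact sub_eq_zero.1 this

/-- The Poisson kernel of the circle of radius `|ζ|`, at a point `z` inside. -/
noncomputable def diskPoisson (z ζ : ℂ) : ℝ := ((ζ + z) / (ζ - z)).re

lemma diskPoisson_nonneg {R : ℝ} {z ζ : ℂ} (hζ : ζ ∈ sphere (0 : ℂ) R) (hz : z ∈ ball (0 : ℂ) R) :
    0 ≤ diskPoisson z ζ := by
  have h := le_re_herglotzRieszKernel hζ hz
  simp only [sub_zero] at h
  refine le_trans ?_ h
  have := mem_ball_zero_iff.1 hz
  have := norm_nonneg z
  exact div_nonneg (by linarith) (by linarith)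

lemma diskPoisson_le {R : ℝ} {z ζ : ℂ} (hζ : ζ ∈ sphere (0 : ℂ) R) (hz : z ∈ ball (0 : ℂ) R) :
    diskPoisson z ζ ≤ (R + ‖z‖) / (R - ‖z‖) := by
  simpa [diskPoisson] using re_herglotzRieszKernel_le hζ hz

lemma continuousOn_diskPoisson {R : ℝ} {z : ℂ} (hz : z ∈ ball (0 : ℂ) R) :
    ContinuousOn (diskPoisson z) (sphere 0 R) := by
  refine Complex.continuous_re.comp_continuousOn (ContinuousOn.div (by fun_prop) (by fun_prop) ?_)
  intro ζ hζ h
  rw [sub_eq_zero.1 h, mem_sphere_zero_iff_norm] at hζ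
  exact (mem_ball_zero_iff.1 hz).ne hζ

lemma circleAverage_diskPoisson {R : ℝ} {z : ℂ} (hz : z ∈ ball (0 : ℂ) R) :
    Real.circleAverage (diskPoisson z) 0 R = 1 := by
  have h := DiffContOnCl.circleAverage_re_herglotzRieszKernel_smul' (f := fun _ => (1 : ℂ))
    diffContOnCl_const hz
  have h2 := Complex.reCLM.circleAverage_comp_comm
    (f := fun ζ : ℂ => ((ζ - 0 + (z - 0)) / (ζ - 0 - (z - 0))).re • (1 : ℂ)) (c := 0) (R := R) ?_
  · rw [h] at h2
    simpa [show diskPoisson z = fun ζ => ((ζ + z) / (ζ - z)).re from rfl, Function.comp_def] using h2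
  · have := Complex.continuous_ofReal.comp_continuousOn (continuousOn_diskPoisson hz)
    simpa [diskPoisson, Function.comp_def] using this.circleIntegrable (pos_of_mem_ball hz).le

lemma norm_circleAverage_le {E : Type*} [NormedAddCommGroup E] [NormedSpace ℝ E] (f : ℂ → E)
    (c : ℂ) (R : ℝ) :
    ‖Real.circleAverage f c R‖ ≤ Real.circleAverage (fun z => ‖f z‖) c R := by
  rw [Real.circleAverage, Real.circleAverage, norm_smul, smul_eq_mul, Real.norm_of_nonneg
    (inv_nonneg.2 Real.two_pi_pos.le)]
  gcongr
  exact intervalIntegral.norm_integral_le_integral_norm Real.two_pi_pos.le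

lemma norm_le_circleAverage_diskPoisson {F : ℂ → ℂ} {R : ℝ} (hF : DiffContOnCl ℂ F (ball 0 R))
    {z : ℂ} (hz : z ∈ ball (0 : ℂ) R) :
    ‖F z‖ ≤ Real.circleAverage (fun ζ => diskPoisson z ζ * ‖F ζ‖) 0 R := by
  have h := DiffContOnCl.circleAverage_re_herglotzRieszKernel_smul' hF hz
  rw [← h]
  refine (norm_circleAverage_le _ _ _).trans (le_of_eq ?_)
  refine Real.circleAverage_congr_sphere fun ζ hζ => ?_
  rw [abs_of_pos (pos_of_mem_ball hz)] at hζ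
  have := diskPoisson_nonneg hζ hz
  simp only [sub_zero, norm_smul]
  rw [Real.norm_of_nonneg (by simpa [diskPoisson] using this), diskPoisson]

lemma sphere_subset_unitBall {R : ℝ} (hR : R < 1) : sphere (0 : ℂ) R ⊆ ball 0 1 :=
  sphere_subset_closedBall.trans (closedBall_subset_ball hR)

lemma circleIntegrable_norm_sq {f : ℂ → ℂ} (hf : DifferentiableOn ℂ f (ball 0 1)) {R : ℝ}
    (hR0 : 0 ≤ R) (hR1 : R < 1) : CircleIntegrable (fun z => ‖f z‖ ^ 2) 0 R :=
  ((hf.continuousOn.mono (sphere_subset_unitBall hR1)).norm.pow 2).circleIntegrable hR0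

lemma exists_circleAverage_le_of_mem_hardySpace {f : ℂ → ℂ} (hf : f ∈ HardySpace) :
    ∃ M : ℝ, 0 ≤ M ∧ ∀ r ∈ Ico (0 : ℝ) 1, Real.circleAverage (fun z => ‖f z‖ ^ 2) 0 r ≤ M := by
  obtain ⟨B, hB⟩ := hf.2
  refine ⟨B ^ 2, sq_nonneg _, fun r hr => ?_⟩
  exact (Real.sqrt_le_left ((Real.sqrt_nonneg _).trans (hB ⟨r, hr, rfl⟩))).1 (hB ⟨r, hr, rfl⟩)

lemma mem_hardySpace_of_circleAverage_le {f : ℂ → ℂ} (hf : DifferentiableOn ℂ f (ball 0 1))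
    {M : ℝ} (h : ∀ r ∈ Ico (0 : ℝ) 1, Real.circleAverage (fun z => ‖f z‖ ^ 2) 0 r ≤ M) :
    f ∈ HardySpace := by
  refine ⟨hf, Real.sqrt M, ?_⟩
  rintro _ ⟨r, hr, rfl⟩
  exact Real.sqrt_le_sqrt (h r hr)

lemma circleAverage_const_mul (a : ℝ) (g : ℂ → ℝ) (R : ℝ) :
    Real.circleAverage (fun ζ => a * g ζ) 0 R = a * Real.circleAverage g 0 R := by
  simpa using Real.circleAverage_fun_smul (a := a) (f := g) (c := 0) (R := R)

lemma circleAverage_diskPoisson_mul_le {g : ℂ → ℝ} {R : ℝ} {z : ℂ} (hz : z ∈ ball (0 : ℂ) R)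
    (hg : ContinuousOn g (sphere 0 R)) (hg0 : ∀ ζ ∈ sphere (0 : ℂ) R, 0 ≤ g ζ) :
    Real.circleAverage (fun ζ => diskPoisson z ζ * g ζ) 0 R
      ≤ (R + ‖z‖) / (R - ‖z‖) * Real.circleAverage g 0 R := by
  have hR := pos_of_mem_ball hz
  rw [← circleAverage_const_mul]
  refine Real.circleAverage_mono (((continuousOn_diskPoisson hz).mul hg).circleIntegrable hR.le)
    ((continuousOn_const.mul hg).circleIntegrable hR.le) fun ζ hζ => ?_
  rw [abs_of_pos hR] at hζ
  exact mul_le_mul_of_nonneg_right (diskPoisson_le hζ hz) (hg0 ζ hζ)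

lemma add_div_sub_le {a R₀ R : ℝ} (ha1 : a < R₀) (h : R₀ ≤ R) (hR : R ≤ 1) :
    (R + a) / (R - a) ≤ 2 / (R₀ - a) :=
  div_le_div₀ (by norm_num) (by linarith) (by linarith) (by linarith)

/-- The mean of a Poisson integral along a holomorphic self map of the disc. -/
lemma circleAverage_poisson_comp {φ : ℂ → ℂ} (hφ : DifferentiableOn ℂ φ (ball 0 1)) {r R : ℝ}
    (hr0 : 0 ≤ r) (hr : r < 1) (hmaps : MapsTo φ (closedBall 0 r) (ball 0 R)) {g : ℂ → ℝ}
    (hg : CircleIntegrable g 0 R) :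
    CircleIntegrable (fun z => Real.circleAverage (fun ζ => diskPoisson (φ z) ζ * g ζ) 0 R) 0 r ∧
    Real.circleAverage (fun z => Real.circleAverage (fun ζ => diskPoisson (φ z) ζ * g ζ) 0 R) 0 r
      = Real.circleAverage (fun ζ => diskPoisson (φ 0) ζ * g ζ) 0 R := by
  set U : ℂ → ℂ := fun u => Real.circleAverage (fun ζ => herglotzRieszKernel 0 u ζ • (g ζ : ℂ)) 0 R
  have hgc : CircleIntegrable (fun ζ => (g ζ : ℂ)) 0 R := by
    simp only [CircleIntegrable, intervalIntegrable_iff] at hg ⊢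
    exact Complex.ofRealCLM.integrable_comp hg
  have hU : DifferentiableOn ℂ U (ball 0 R) :=
    differentiableOn_circleAverage_herglotzRieszKernel_smul hgc
  have hre : ∀ u ∈ ball (0 : ℂ) R,
      (U u).re = Real.circleAverage (fun ζ => diskPoisson u ζ * g ζ) 0 R := by
    intro u hu
    rw [re_circleAverage_herglotzRieszKernel_smul hg hu]
    congr 1
    ext ζ
    simp [diskPoisson, herglotzRieszKernel]
  have hV : DifferentiableOn ℂ (U ∘ φ) (closedBall 0 r) :=
    hU.comp (hφ.mono (closedBall_subset_ball hr)) hmaps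
  have hsph : EqOn (Complex.re ∘ (U ∘ φ))
      (fun z => Real.circleAverage (fun ζ => diskPoisson (φ z) ζ * g ζ) 0 R) (sphere 0 r) :=
    fun z hz => hre _ (hmaps (sphere_subset_closedBall hz))
  have hVs : ContinuousOn (U ∘ φ) (sphere 0 r) := hV.continuousOn.mono sphere_subset_closedBall
  refine ⟨((Complex.continuous_re.comp_continuousOn hVs).congr hsph.symm).circleIntegrable hr0, ?_⟩
  have h1 := Complex.reCLM.circleAverage_comp_comm (hVs.circleIntegrable hr0)
  have h2 : Real.circleAverage (U ∘ φ) 0 r = (U ∘ φ) 0 := by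
    apply DiffContOnCl.circleAverage
    rw [abs_of_nonneg hr0]
    exact hV.diffContOnCl_ball Subset.rfl
  rw [h2] at h1
  rw [← Real.circleAverage_congr_sphere (f₁ := Complex.re ∘ (U ∘ φ))
    (by rwa [abs_of_nonneg hr0])]
  refine h1.trans ?_
  exact hre _ (hmaps (by simpa using hr0))

/-- Littlewood's subordination principle: composition operators preserve `H²`. -/
lemma comp_mem_hardySpace {φ f : ℂ → ℂ} (hφ : IsDiscSelfMap φ) (hf : f ∈ HardySpace) :
    (fun z => f (φ z)) ∈ HardySpace := by
  obtain ⟨M, hM0, hM⟩ := exists_circleAverage_le_of_mem_hardySpace hf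
  have ha : ‖φ 0‖ < 1 := mem_ball_zero_iff.1 (hφ.2 (mem_ball_self one_pos))
  set R₀ : ℝ := (1 + ‖φ 0‖) / 2 with hR₀
  have hcomp : DifferentiableOn ℂ (fun z => f (φ z)) (ball 0 1) := hf.1.comp hφ.1 hφ.2
  refine mem_hardySpace_of_circleAverage_le hcomp (M := 2 / (R₀ - ‖φ 0‖) * M) fun r hr => ?_
  obtain ⟨x, hx, hmax⟩ := (isCompact_closedBall (0 : ℂ) r).exists_isMaxOn
    ⟨0, by simpa using hr.1⟩
    (hφ.1.continuousOn.mono (closedBall_subset_ball hr.2)).norm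
  have hx1 : ‖φ x‖ < 1 := mem_ball_zero_iff.1 (hφ.2 (closedBall_subset_ball hr.2 hx))
  obtain ⟨R, hR, hR1⟩ := exists_between (max_lt hx1 (show R₀ < 1 by rw [hR₀]; linarith))
  have hRx := (le_max_left _ _).trans_lt hR
  have hRR := (le_max_right _ _).trans_lt hR
  have hR0 : 0 ≤ R := (norm_nonneg _).trans hRx.le
  have hmaps : MapsTo φ (closedBall 0 r) (ball 0 R) := fun z hz =>
    mem_ball_zero_iff.2 ((show ‖φ z‖ ≤ ‖φ x‖ from hmax hz).trans_lt hRx)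
  have hcl : DiffContOnCl ℂ (fun z => f z ^ 2) (ball 0 R) :=
    ((hf.1.pow 2).mono (closedBall_subset_ball hR1)).diffContOnCl_ball Subset.rfl
  have hgc : ContinuousOn (fun z => ‖f z‖ ^ 2) (sphere 0 R) :=
    (hf.1.continuousOn.mono (sphere_subset_unitBall hR1)).norm.pow 2
  obtain ⟨hint, havg⟩ := circleAverage_poisson_comp hφ.1 hr.1 hr.2 hmaps
    (circleIntegrable_norm_sq hf.1 hR0 hR1)
  calc Real.circleAverage (fun z => ‖f (φ z)‖ ^ 2) 0 r
      ≤ Real.circleAverage (fun z => Real.circleAverage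
          (fun ζ => diskPoisson (φ z) ζ * ‖f ζ‖ ^ 2) 0 R) 0 r := by
        refine Real.circleAverage_mono (circleIntegrable_norm_sq hcomp hr.1 hr.2) hint ?_
        intro z hz
        rw [abs_of_nonneg hr.1] at hz
        simpa using norm_le_circleAverage_diskPoisson hcl (hmaps (sphere_subset_closedBall hz))
    _ = Real.circleAverage (fun ζ => diskPoisson (φ 0) ζ * ‖f ζ‖ ^ 2) 0 R := havg
    _ ≤ (R + ‖φ 0‖) / (R - ‖φ 0‖) * Real.circleAverage (fun ζ => ‖f ζ‖ ^ 2) 0 R :=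
        circleAverage_diskPoisson_mul_le (hmaps (by simpa using hr.1)) hgc
          fun _ _ => by positivity
    _ ≤ 2 / (R₀ - ‖φ 0‖) * M := by
        have h0 : 0 < R₀ - ‖φ 0‖ := by rw [hR₀]; linarith
        refine mul_le_mul (add_div_sub_le (by linarith) hRR.le hR1.le)
          (hM R ⟨hR0, hR1⟩) ?_ (by positivity)
        exact Real.circleAverage_nonneg_of_nonneg fun _ _ => by positivity

lemma circleMap_zero_mem_ball {r : ℝ} (hr : r ∈ Ico (0 : ℝ) 1) (t : ℝ) :
    circleMap 0 r t ∈ ball (0 : ℂ) 1 := by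
  rw [mem_ball_zero_iff, norm_circleMap_zero, abs_of_nonneg hr.1]
  exact hr.2

lemma eventually_mem_Ico_nhdsLT_one {a : ℝ} (ha : a < 1) : ∀ᶠ r in 𝓝[<] (1 : ℝ), r ∈ Ico a 1 :=
  Ico_mem_nhdsLT ha

lemma ae_exists_radialLimit {θ : ℂ → ℂ} (hθ : IsInner θ) :
    ∀ᵐ t : ℝ, t ∈ uIoc 0 (2 * Real.pi) →
      ∃ ζ : ℂ, ‖ζ‖ = 1 ∧ Tendsto (fun r : ℝ => θ (circleMap 0 r t)) (𝓝[<] 1) (𝓝 ζ) := by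
  have h := (ae_restrict_iff' measurableSet_Icc).1 hθ.2.2
  filter_upwards [h] with t ht hmem
  rw [uIoc_of_le Real.two_pi_pos.le] at hmem
  exact ht (Ioc_subset_Icc_self hmem)

/-- The part of `|g|`, truncated at `K`, that exceeds one. -/
noncomputable def truncExcess (K : ℝ) (g : ℂ → ℂ) (z : ℂ) : ℝ := max (min ‖g z‖ K - 1) 0

lemma truncExcess_nonneg (K : ℝ) (g : ℂ → ℂ) (z : ℂ) : 0 ≤ truncExcess K g z := le_max_right _ _

lemma norm_le_truncExcess {K : ℝ} (hK : 0 < K) (g : ℂ → ℂ) (z : ℂ) :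
    ‖g z‖ ≤ 1 + truncExcess K g z + ‖g z‖ ^ 2 / K := by
  have h1 : min ‖g z‖ K - 1 ≤ truncExcess K g z := le_max_left _ _
  rcases le_total ‖g z‖ K with h | h
  · rw [min_eq_left h] at h1
    have : 0 ≤ ‖g z‖ ^ 2 / K := by positivity
    linarith
  · have h2 : ‖g z‖ ≤ ‖g z‖ ^ 2 / K := by
      rw [le_div_iff₀ hK]; nlinarith [norm_nonneg (g z)]
    linarith [truncExcess_nonneg K g z]

lemma ContinuousOn.truncExcess {g : ℂ → ℂ} {s : Set ℂ} (hg : ContinuousOn g s) (K : ℝ) :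
    ContinuousOn (truncExcess K g) s :=
  ((hg.norm.inf continuousOn_const).sub continuousOn_const).sup continuousOn_const

lemma tendsto_truncExcess {θ g : ℂ → ℂ} {K : ℝ} (hb : ∀ z ∈ ball (0 : ℂ) 1, ‖θ z * g z‖ ≤ 1)
    {t : ℝ} {ζ : ℂ} (hζ : ‖ζ‖ = 1)
    (h : Tendsto (fun r : ℝ => θ (circleMap 0 r t)) (𝓝[<] 1) (𝓝 ζ)) :
    Tendsto (fun r : ℝ => truncExcess K g (circleMap 0 r t)) (𝓝[<] 1) (𝓝 0) := by
  have hn : Tendsto (fun r : ℝ => ‖θ (circleMap 0 r t)‖) (𝓝[<] 1) (𝓝 1) := hζ ▸ h.norm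
  have hup : Tendsto (fun r : ℝ => max (‖θ (circleMap 0 r t)‖⁻¹ - 1) 0) (𝓝[<] 1) (𝓝 0) := by
    simpa using ((hn.inv₀ one_ne_zero).sub_const 1).max (tendsto_const_nhds (x := (0 : ℝ)))
  refine tendsto_of_tendsto_of_tendsto_of_le_of_le' tendsto_const_nhds hup
    (Eventually.of_forall fun r => truncExcess_nonneg _ _ _) ?_
  filter_upwards [hn.eventually (lt_mem_nhds one_pos), eventually_mem_Ico_nhdsLT_one one_pos]
    with r hpos hr
  have h1 := hb _ (circleMap_zero_mem_ball hr t)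
  rw [norm_mul, mul_comm, ← le_div_iff₀ hpos, one_div] at h1
  exact max_le_max_right 0 (sub_le_sub_right ((min_le_left _ _).trans h1) 1)

lemma tendsto_circleAverage_truncExcess {θ g : ℂ → ℂ} (hθ : IsInner θ)
    (hg : DifferentiableOn ℂ g (ball 0 1)) (hb : ∀ z ∈ ball (0 : ℂ) 1, ‖θ z * g z‖ ≤ 1)
    {K : ℝ} (hK : 0 ≤ K) :
    Tendsto (fun r : ℝ => Real.circleAverage (truncExcess K g) 0 r) (𝓝[<] 1) (𝓝 0) := by
  have key : Tendsto (fun r : ℝ => ∫ t in (0 : ℝ)..2 * Real.pi, truncExcess K g (circleMap 0 r t))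
      (𝓝[<] 1) (𝓝 (∫ _ in (0 : ℝ)..2 * Real.pi, (0 : ℝ))) := by
    refine intervalIntegral.tendsto_integral_filter_of_dominated_convergence (fun _ => K) ?_ ?_
      intervalIntegrable_const ?_
    · filter_upwards [eventually_mem_Ico_nhdsLT_one one_pos] with r hr
      refine Continuous.aestronglyMeasurable ?_
      exact (hg.continuousOn.truncExcess K).comp_continuous (continuous_circleMap 0 r)
        fun t => circleMap_zero_mem_ball hr t
    · refine Eventually.of_forall fun r => Eventually.of_forall fun t _ => ?_
      rw [Real.norm_of_nonneg (truncExcess_nonneg _ _ _)]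
      exact max_le (by linarith [min_le_right ‖g (circleMap 0 r t)‖ K]) hK
    · filter_upwards [ae_exists_radialLimit hθ] with t ht hmem
      obtain ⟨ζ, hζ, hlim⟩ := ht hmem
      exact tendsto_truncExcess hb hζ hlim
  simpa [Real.circleAverage_def] using key.const_mul (2 * Real.pi)⁻¹

/-- If `θ` is inner, `g ∈ H²` and `|θ g| ≤ 1`, then `|g| ≤ 1`. -/
lemma norm_le_one_of_inner_mul {θ g : ℂ → ℂ} (hθ : IsInner θ) (hg : g ∈ HardySpace)
    (hb : ∀ z ∈ ball (0 : ℂ) 1, ‖θ z * g z‖ ≤ 1) {z : ℂ} (hz : z ∈ ball (0 : ℂ) 1) :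
    ‖g z‖ ≤ 1 := by
  obtain ⟨M, hM0, hM⟩ := exists_circleAverage_le_of_mem_hardySpace hg
  have ha : ‖z‖ < 1 := mem_ball_zero_iff.1 hz
  set R₀ : ℝ := (1 + ‖z‖) / 2 with hR₀
  have hR₀1 : R₀ < 1 := by rw [hR₀]; linarith
  have hzR₀ : ‖z‖ < R₀ := by rw [hR₀]; linarith
  have hR₀0 : 0 ≤ R₀ := (norm_nonneg _).trans hzR₀.le
  set C : ℝ := 2 / (R₀ - ‖z‖) with hC
  have hC0 : 0 ≤ C := div_nonneg zero_le_two (by linarith)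
  have step : ∀ K : ℝ, 0 < K → ‖g z‖ ≤ 1 + C * (K⁻¹ * M) := by
    intro K hK
    have hlim : Tendsto (fun r : ℝ => 1 + C * (Real.circleAverage (truncExcess K g) 0 r + K⁻¹ * M))
        (𝓝[<] 1) (𝓝 (1 + C * (0 + K⁻¹ * M))) :=
      (((tendsto_circleAverage_truncExcess hθ hg.1 hb hK.le).add_const _).const_mul C).const_add 1
    rw [zero_add] at hlim
    refine ge_of_tendsto hlim ?_
    filter_upwards [eventually_mem_Ico_nhdsLT_one hR₀1] with r hr
    have hr0 : 0 ≤ r := hR₀0.trans hr.1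
    have hzr : z ∈ ball (0 : ℂ) r := mem_ball_zero_iff.2 (hzR₀.trans_le hr.1)
    have hgs : ContinuousOn g (sphere 0 r) := hg.1.continuousOn.mono (sphere_subset_unitBall hr.2)
    have hcl : DiffContOnCl ℂ g (ball 0 r) :=
      (hg.1.mono (closedBall_subset_ball hr.2)).diffContOnCl_ball Subset.rfl
    have hP := continuousOn_diskPoisson hzr
    set e : ℂ → ℝ := fun ζ => truncExcess K g ζ + K⁻¹ * ‖g ζ‖ ^ 2 with he
    have hsq : ContinuousOn (fun ζ => K⁻¹ * ‖g ζ‖ ^ 2) (sphere 0 r) :=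
      continuousOn_const.mul (hgs.norm.pow 2)
    have hes : ContinuousOn e (sphere 0 r) := (hgs.truncExcess K).add hsq
    have he0 : ∀ ζ, 0 ≤ e ζ := fun ζ => add_nonneg (truncExcess_nonneg _ _ _) (by positivity)
    have hPe : CircleIntegrable (fun ζ => diskPoisson z ζ * e ζ) 0 r :=
      (hP.mul hes).circleIntegrable hr0
    calc ‖g z‖ ≤ Real.circleAverage (fun ζ => diskPoisson z ζ * ‖g ζ‖) 0 r :=
          norm_le_circleAverage_diskPoisson hcl hzr
      _ ≤ Real.circleAverage (fun ζ => diskPoisson z ζ + diskPoisson z ζ * e ζ) 0 r := by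
          refine Real.circleAverage_mono ((hP.mul hgs.norm).circleIntegrable hr0)
            ((hP.circleIntegrable hr0).add hPe) fun ζ hζ => ?_
          rw [abs_of_nonneg hr0] at hζ
          rw [← mul_one_add]
          refine mul_le_mul_of_nonneg_left ?_ (diskPoisson_nonneg hζ hzr)
          have := norm_le_truncExcess hK g ζ
          rw [div_eq_inv_mul] at this
          simp only [he]
          linarith
      _ = 1 + Real.circleAverage (fun ζ => diskPoisson z ζ * e ζ) 0 r := by
          rw [Real.circleAverage_fun_add (hP.circleIntegrable hr0) hPe,
            circleAverage_diskPoisson hzr]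
      _ ≤ 1 + (r + ‖z‖) / (r - ‖z‖) * Real.circleAverage e 0 r := by
          gcongr
          exact circleAverage_diskPoisson_mul_le hzr hes fun ζ _ => he0 ζ
      _ ≤ 1 + C * (Real.circleAverage (truncExcess K g) 0 r + K⁻¹ * M) := by
          gcongr
          · exact Real.circleAverage_nonneg_of_nonneg fun ζ _ => he0 ζ
          · exact add_div_sub_le hzR₀ hr.1 hr.2.le
          · rw [he, Real.circleAverage_fun_add ((hgs.truncExcess K).circleIntegrable hr0)
              (hsq.circleIntegrable hr0), circleAverage_const_mul]
            gcongr
            exact hM r ⟨hr0, hr.2⟩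
  have hlim : Tendsto (fun K : ℝ => 1 + C * (K⁻¹ * M)) atTop (𝓝 (1 + C * (0 * M))) :=
    ((tendsto_inv_atTop_zero.mul_const M).const_mul C).const_add 1
  rw [zero_mul, mul_zero, add_zero] at hlim
  exact ge_of_tendsto hlim ((eventually_gt_atTop 0).mono step)

lemma IsInner.norm_eq_one_of_eq_const {θ : ℂ → ℂ} (hθ : IsInner θ) {c : ℂ}
    (hc : ∀ z ∈ ball (0 : ℂ) 1, θ z = c) : ‖c‖ = 1 := by
  have hne : NeBot (ae (volume.restrict (Icc 0 (2 * Real.pi)))) := by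
    rw [ae_neBot, Ne, Measure.restrict_eq_zero, Real.volume_Icc, ENNReal.ofReal_eq_zero, not_le,
      sub_zero]
    exact Real.two_pi_pos
  obtain ⟨t, ζ, hζ, hlim⟩ := hθ.2.2.exists
  have h : Tendsto (fun r : ℝ => θ (circleMap 0 r t)) (𝓝[<] 1) (𝓝 c) := by
    refine tendsto_const_nhds.congr' ?_
    filter_upwards [eventually_mem_Ico_nhdsLT_one one_pos] with r hr
    exact (hc _ (circleMap_zero_mem_ball hr t)).symm
  rw [tendsto_nhds_unique h hlim, hζ]

lemma one_mem_hardySpace : (fun _ => 1 : ℂ → ℂ) ∈ HardySpace :=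
  mem_hardySpace_of_circleAverage_le (differentiableOn_const 1) (M := 1) fun r _ => by
    simp [Real.circleAverage_const]

lemma beurlingInvariant_of_eq_const {φ θ : ℂ → ℂ} (hφ : IsDiscSelfMap φ) {c : ℂ}
    (hc : ∀ z ∈ ball (0 : ℂ) 1, θ z = c) : BeurlingInvariant φ θ := by
  rintro _ ⟨h, ⟨f, hf, hfh⟩, rfl⟩
  refine ⟨fun z => f (φ z), comp_mem_hardySpace hφ hf, fun z hz => ?_⟩
  have h1 := hfh (hφ.2 hz)
  simp only [compositionOp] at h1 ⊢
  rw [h1, hc z hz, hc _ (hφ.2 hz)]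

/-- Invariance of `θ H²` forces `θ ∘ φ = θ` when `θ` does not vanish at a fixed point of `φ`. -/
lemma comp_eq_of_beurlingInvariant {φ θ : ℂ → ℂ} (hφ : IsDiscSelfMap φ) {w : ℂ}
    (hw : w ∈ ball (0 : ℂ) 1) (hfix : φ w = w) (hθ : IsInner θ) (hθw : θ w ≠ 0)
    (hinv : BeurlingInvariant φ θ) : ∀ z ∈ ball (0 : ℂ) 1, θ (φ z) = θ z := by
  obtain ⟨g, hg, hgeq⟩ := hinv (mem_image_of_mem _
    (show θ ∈ beurlingSpace θ from ⟨_, one_mem_hardySpace, fun z _ => (mul_one (θ z)).symm⟩))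
  have hg1 : ∀ z ∈ ball (0 : ℂ) 1, ‖g z‖ ≤ 1 := fun z hz =>
    norm_le_one_of_inner_mul hθ hg (fun u hu => (congrArg norm (hgeq hu)).ge.trans (hθ.2.1 _ (hφ.2 hu))) hz
  have hgw : g w = 1 := by
    have h := hgeq hw
    simp only [compositionOp, hfix] at h
    exact mul_left_cancel₀ hθw (by rw [← h, mul_one])
  have hconst := Complex.eq_const_of_exists_max hg.1 hw
    (isMaxOn_iff.2 fun z hz => by simpa [hgw] using hg1 z hz)
  intro z hz
  have h1 : g z = 1 := by simpa [hgw] using hconst hz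
  simpa [h1, compositionOp] using hgeq hz

lemma IsSingularInner.ne_zero {θ : ℂ → ℂ} (hθ : IsSingularInner θ) {z : ℂ}
    (hz : z ∈ ball (0 : ℂ) 1) : θ z ≠ 0 := by
  obtain ⟨-, c, μ, hc, -, -, -, -, h⟩ := hθ
  rw [h z hz]
  exact mul_ne_zero (norm_ne_zero_iff.1 (by simp [hc])) (Complex.exp_ne_zero _)

lemma IsSingularInner.norm_zero_lt_one {θ : ℂ → ℂ} (hθ : IsSingularInner θ) : ‖θ 0‖ < 1 := by
  obtain ⟨-, c, μ, hc, hfin, hμ, -, -, h⟩ := hθ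
  rw [h 0 (mem_ball_self one_pos), norm_mul, hc, one_mul, Complex.norm_exp, Real.exp_lt_one_iff]
  have hμ' : 0 < μ.real univ := by
    rw [measureReal_def, ENNReal.toReal_pos_iff]
    exact ⟨Measure.measure_univ_pos.2 hμ, measure_lt_top _ _⟩
  have h1 : ∀ t : ℝ, circleMap 0 1 t / circleMap 0 1 t = 1 := fun t =>
    div_self (circleMap_ne_center one_ne_zero)
  simp only [add_zero, sub_zero, h1]
  simpa using hμ'

theorem corollary3p5 (φ : ℂ → ℂ) (hφ : IsDiscSelfMap φ) (hna : ¬ IsDiscAutomorphism φ)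
    (w : ℂ) (hw : w ∈ ball (0 : ℂ) 1) (hfix : φ w = w) :
    (∀ θ : ℂ → ℂ, IsInner θ → θ w ≠ 0 →
      (BeurlingInvariant φ θ ↔ ∃ c : ℂ, ‖c‖ = 1 ∧ ∀ z ∈ ball (0 : ℂ) 1, θ z = c)) ∧
    (∀ θ : ℂ → ℂ, IsSingularInner θ → ¬ BeurlingInvariant φ θ) := by
  have main : ∀ θ : ℂ → ℂ, IsInner θ → θ w ≠ 0 → BeurlingInvariant φ θ →
      ∃ c : ℂ, ‖c‖ = 1 ∧ ∀ z ∈ ball (0 : ℂ) 1, θ z = c := by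
    intro θ hθ hθw hinv
    have hconst : ∀ z ∈ ball (0 : ℂ) 1, θ z = θ w := fun z hz =>
      eq_const_of_comp_eq hφ hna hw hfix hθ.1
        (comp_eq_of_beurlingInvariant hφ hw hfix hθ hθw hinv) hz
    exact ⟨θ w, hθ.norm_eq_one_of_eq_const hconst, hconst⟩
  refine ⟨fun θ hθ hθw => ⟨main θ hθ hθw, ?_⟩, fun θ hθ hinv => ?_⟩
  · rintro ⟨c, -, hc⟩
    exact beurlingInvariant_of_eq_const hφ hc
  · obtain ⟨c, hc, hconst⟩ := main θ hθ.1 (hθ.ne_zero hw) hinv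
    have h := hθ.norm_zero_lt_one
    rw [hconst 0 (mem_ball_self one_pos), hc] at h
    exact lt_irrefl _ h
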